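/- Let $m\ge 0$ be an integer and let $(X_i)_{i\ge 1}$ be a sequence of non-negative real random variables which is strictly stationary and $m$-dependent, that is, for all $A,B\subset\{1,2,\dots\}$ with $|i-j|>m$ for every $i\in A$, $j\in B$, the families $(X_i)_{i\in A}$ and $(X_j)_{j\in B}$ are independent. Put $\mu:=\mathbb{E}[X_1]$, $\sigma^2:=\mathrm{Var}(X_1)$, $a_j:=\mathrm{Cov}(X_1,X_{1+j})$, and assume that $\mathbb{E}|X_1|^3<\infty$, $\mu>0$, $\sigma^2>0$ and $\sigma^2+2\sum_{j=1}^m a_j>0$. Let $(Y_i)_{i\ge 1}$ be i.i.d. random variables with values in $\{0,1,2,\dots\}$, defined on the same probability space, with $\nu:=\mathbb{E}[Y_1]>0$, $\tau^2:=\mathrm{Var}(Y_1)>0$ and $\mathbb{E}|Y_1|^3<\infty$, and suppose that the sequences $(X_i)_{i\ge1}$ and $(Y_i)_{i\ge1}$ are independent of each other. Define $N_n=\sum_{i=1}^n Y_i$. Then $$\frac{\sum_{i=1}^{N_n} X_i-n\mu\nu}{\sqrt{n\left(\nu\sigma^2+2\nu\sum_{j=1}^m a_j+\tau^2\mu^2\right)}}\longrightarrow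 N(0,1)$$ in distribution as $n\to\infty$. -/

import Mathlib

open MeasureTheory ProbabilityTheory Filter

/-- A real-valued process `(X i)` indexed by `ℕ` is (strictly) stationary under `P`: for every
`k`, every shift `h` and all times `i 0, …, i (k - 1)`, the vectors
`(X (i 0 + h), …, X (i (k - 1) + h))` and `(X (i 0), …, X (i (k - 1)))` have the same joint law. -/
def IsStationaryProcess {Ω : Type*} [MeasurableSpace Ω] (X : ℕ → Ω → ℝ) (P : Measure Ω) : Prop :=
  ∀ (k h : ℕ) (i : Fin k → ℕ),
    IdentDistrib (fun ω (j : Fin k) => X (i j + h) ω) (fun ω (j : Fin k) => X (i j) ω) P P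

/-- A real-valued process `(X i)` indexed by `ℕ` is `m`-dependent under `P`: whenever two sets of
times `A`, `B` are at distance larger than `m` from each other, the families `(X i)_{i ∈ A}` and
`(X j)_{j ∈ B}` are independent. -/
def IsMDependent {Ω : Type*} [MeasurableSpace Ω] (m : ℕ) (X : ℕ → Ω → ℝ) (P : Measure Ω) : Prop :=
  ∀ A B : Set ℕ, (∀ i ∈ A, ∀ j ∈ B, (m : ℤ) < |(i : ℤ) - (j : ℤ)|) →
    IndepFun (fun ω (i : A) => X i ω) (fun ω (j : B) => X j ω) P

/-- The random index `N_n = ∑ Y_i`, the sum of the first `n` terms of the sequence `Y`. -/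
def randomIndex {Ω : Type*} (Y : ℕ → Ω → ℕ) (n : ℕ) (ω : Ω) : ℕ :=
  ∑ i ∈ Finset.range n, Y i ω

/-!
The theorem is the central limit theorem for a sum of `m`-dependent terms with an independent
random number of summands. Everything runs through characteristic functions and the Lévy
continuity theorem, with one comparison tool: if `A - B` is small in `L²`, the characteristic
functions of `A` and `B` are close (`norm_charFun_map_sub_le`).

For a centred stationary `m`-dependent sequence, the sum over any finite set `F` of indices has
second moment at most a constant times `|F|` (`integral_sum_sq_le`), because each index is
correlated with at most `2 m + 1` indices, itself included; and the second moment of the sum of `p` consecutive terms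
is exactly affine in `p ≥ m`, with slope the long-run variance
`v = Var X₀ + 2 ∑_{j ≤ m} Cov (X₀, X_j)` (`integral_sum_range_add_sq`).

The central limit theorem for such a sequence (`tendsto_charFun_inv_sqrt_mul_sum`) follows by
Bernstein's blocks. Cut the first `n` integers into blocks of length `p` separated by gaps of length
`m`. The block sums are i.i.d., so for fixed `p` the classical central limit theorem applies to
them; the gaps contribute at most a multiple of `m / (p + m)` to the normalised second moment. Then
let `p → ∞`.

For the random sum (`tendsto_charFun_random_sum`), compare the centred sum `S` at the random index
`N_n` with its value at `k = ⌊ν n⌋`. As `X` and `N_n` are independent,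
`𝔼 (S_{N_n} - S_k)² ≤ C 𝔼 |N_n - k| = O(√n)`, which is negligible after division by `n`. What is
left is `S_k + μ (N_n - n ν)`, a sum of two independent variables, each of which is asymptotically
normal once divided by `√n`; the characteristic functions multiply and the variances add up to
`ν v + τ² μ²`.
-/

open scoped Topology

/-! ### Comparison of characteristic functions -/

section CharFun

variable {Ω : Type*} [MeasurableSpace Ω] {P : Measure Ω} [IsProbabilityMeasure P]

lemma integral_abs_le_sqrt_integral_sq {D : Ω → ℝ} (hD : MemLp D 2 P) :
    ∫ ω, |D ω| ∂P ≤ √(∫ ω, D ω ^ 2 ∂P) := by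
  have h := variance_nonneg (fun ω => |D ω|) P
  rw [variance_eq_sub (X := fun ω => |D ω|) hD.abs] at h
  refine Real.le_sqrt_of_sq_le ?_
  simpa [sq_abs] using h

/-- Characteristic functions are Lipschitz in the `L²` distance of the variables, since
`x ↦ exp (i t x)` is `|t|`-Lipschitz. -/
lemma norm_charFun_map_sub_le {A B : Ω → ℝ} (hA : AEMeasurable A P) (hB : AEMeasurable B P)
    (hD : MemLp (fun ω => A ω - B ω) 2 P) (t : ℝ) :
    ‖charFun (P.map A) t - charFun (P.map B) t‖ ≤ |t| * √(∫ ω, (A ω - B ω) ^ 2 ∂P) := by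
  have key : ∀ C : Ω → ℝ, AEMeasurable C P →
      Integrable (fun ω => Complex.exp (t * C ω * Complex.I)) P := fun C hC =>
    Integrable.of_bound (C := 1) (by fun_prop) (.of_forall fun ω => by
      rw [← Complex.ofReal_mul, Complex.norm_exp_ofReal_mul_I])
  have hmap : ∀ C : Ω → ℝ, AEMeasurable C P →
      charFun (P.map C) t = ∫ ω, Complex.exp (t * C ω * Complex.I) ∂P := fun C hC => by
    rw [charFun_apply_real, integral_map hC (by fun_prop)]
  rw [hmap A hA, hmap B hB, ← integral_sub (key A hA) (key B hB)]
  calc _ ≤ ∫ ω, |t| * |A ω - B ω| ∂P := by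
        refine norm_integral_le_of_norm_le ((hD.integrable one_le_two).abs.const_mul _)
          (.of_forall fun ω => ?_)
        have h1 : Complex.exp (t * A ω * Complex.I) - Complex.exp (t * B ω * Complex.I)
            = Complex.exp ((t * B ω : ℝ) * Complex.I) *
              (Complex.exp (Complex.I * (t * (A ω - B ω) : ℝ)) - 1) := by
          rw [mul_sub, ← Complex.exp_add]
          push_cast
          ring_nf
        rw [h1, norm_mul, Complex.norm_exp_ofReal_mul_I, one_mul, ← abs_mul]
        exact Real.norm_exp_I_mul_ofReal_sub_one_le
    _ = |t| * ∫ ω, |A ω - B ω| ∂P := integral_const_mul _ _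
    _ ≤ _ := by gcongr; exact integral_abs_le_sqrt_integral_sq hD

/-- Slutsky's theorem for a convergent deterministic factor and a centred normal limit, for
sequences bounded in `L²`. -/
lemma tendsto_charFun_const_mul {A : ℕ → Ω → ℝ} {c : ℕ → ℝ} {c₀ v C t : ℝ}
    (hA : ∀ n, MemLp (A n) 2 P) (hC : ∀ n, ∫ ω, A n ω ^ 2 ∂P ≤ C) (hc : Tendsto c atTop (𝓝 c₀))
    (h : ∀ t : ℝ, Tendsto (fun n => charFun (P.map (A n)) t) atTop
      (𝓝 (Complex.exp (-(v * t ^ 2 / 2 : ℝ))))) :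
    Tendsto (fun n => charFun (P.map (fun ω => c n * A n ω)) t) atTop
      (𝓝 (Complex.exp (-(v * c₀ ^ 2 * t ^ 2 / 2 : ℝ)))) := by
  have h1 : Tendsto (fun n => charFun (P.map (fun ω => c₀ * A n ω)) t) atTop
      (𝓝 (Complex.exp (-(v * c₀ ^ 2 * t ^ 2 / 2 : ℝ)))) := by
    have := h (c₀ * t)
    rw [mul_pow, ← mul_assoc] at this
    refine this.congr fun n => ?_
    rw [charFun_map_mul_comp (hA n).aemeasurable]
  have h2 : Tendsto (fun n => |t| * (|c n - c₀| * √C)) atTop (𝓝 0) := by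
    have : Tendsto (fun n => |c n - c₀|) atTop (𝓝 0) := by
      simpa using (hc.sub_const c₀).abs
    simpa using (this.mul_const (√C)).const_mul |t|
  have h3 : Tendsto (fun n => charFun (P.map (fun ω => c n * A n ω)) t -
      charFun (P.map (fun ω => c₀ * A n ω)) t) atTop (𝓝 0) := by
    refine squeeze_zero_norm (fun n => ?_) h2
    have hD : MemLp (fun ω => c n * A n ω - c₀ * A n ω) 2 P :=
      ((hA n).const_mul _).sub ((hA n).const_mul _)
    refine (norm_charFun_map_sub_le ((hA n).aemeasurable.const_mul _)
      ((hA n).aemeasurable.const_mul _) hD t).trans ?_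
    simp_rw [← sub_mul, mul_pow]
    rw [integral_const_mul, Real.sqrt_mul (sq_nonneg _), Real.sqrt_sq_eq_abs]
    gcongr
    exact hC n
  simpa using h3.add h1

end CharFun

/-- Interchange of limits: `f n` is approximated by `g p n`, whose limit in `n` is `L p`, with an
error that vanishes when first `n → ∞` and then `p → ∞`. -/
lemma tendsto_of_approx {f : ℕ → ℂ} {g : ℕ → ℕ → ℂ} {L : ℕ → ℂ} {l : ℂ} {e : ℕ → ℕ → ℝ}
    {e' : ℕ → ℝ}
    (hg : ∀ᶠ p in atTop, Tendsto (g p) atTop (𝓝 (L p))) (hL : Tendsto L atTop (𝓝 l))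
    (hfg : ∀ p n, ‖f n - g p n‖ ≤ e p n) (he : ∀ p, Tendsto (e p) atTop (𝓝 (e' p)))
    (he' : Tendsto e' atTop (𝓝 0)) : Tendsto f atTop (𝓝 l) := by
  rw [Metric.tendsto_atTop']
  intro ε hε
  have h1 := (Metric.tendsto_nhds.1 hL) (ε / 3) (by positivity)
  have h2 := he'.eventually_lt_const (show (0 : ℝ) < ε / 3 by positivity)
  obtain ⟨p, hgp, hp1, hp2⟩ := (hg.and (h1.and h2)).exists
  have h3 := (Metric.tendsto_nhds.1 hgp) (ε / 3) (by positivity)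
  have h4 := (he p).eventually_lt_const hp2
  obtain ⟨N, hN⟩ := eventually_atTop.1 (h3.and h4)
  refine ⟨N, fun n hn => ?_⟩
  obtain ⟨a, b⟩ := hN n hn.le
  calc dist (f n) l ≤ dist (f n) (g p n) + dist (g p n) (L p) + dist (L p) l :=
        dist_triangle4 _ _ _ _
    _ < ε := by
        have := hfg p n
        rw [← dist_eq_norm] at this
        linarith

/-! ### Stationary and `m`-dependent processes -/

section MDependent

variable {Ω : Type*} [MeasurableSpace Ω] {P : Measure Ω} {m : ℕ} {X : ℕ → Ω → ℝ}

lemma IsStationaryProcess.sub_const (hX : IsStationaryProcess X P) (c : ℝ) :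
    IsStationaryProcess (fun i ω => X i ω - c) P := fun k h i =>
  (hX k h i).comp (u := fun x j => x j - c) (by fun_prop)

lemma IsMDependent.sub_const (hX : IsMDependent m X P) (c : ℝ) :
    IsMDependent m (fun i ω => X i ω - c) P := fun A B hAB =>
  (hX A B hAB).comp (φ := fun x j => x j - c) (ψ := fun x j => x j - c) (by fun_prop)
    (by fun_prop)

lemma IsStationaryProcess.identDistrib (hX : IsStationaryProcess X P) (i : ℕ) :
    IdentDistrib (X i) (X 0) P P := by
  simpa [Function.comp_def] using (hX 1 i (fun _ => 0)).comp (u := fun x => x 0) (by fun_prop)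

lemma IsStationaryProcess.identDistrib_sum (hX : IsStationaryProcess X P) (h p : ℕ) :
    IdentDistrib (fun ω => ∑ i ∈ Finset.range p, X (h + i) ω)
      (fun ω => ∑ i ∈ Finset.range p, X i ω) P P := by
  have := (hX p h (fun j => j)).comp (u := fun x => ∑ j, x j) (by fun_prop)
  simpa [Function.comp_def, Finset.sum_range, add_comm] using this

lemma IsStationaryProcess.integral_mul_add (hX : IsStationaryProcess X P) (i j : ℕ) :
    ∫ ω, X i ω * X (i + j) ω ∂P = ∫ ω, X 0 ω * X j ω ∂P := by
  have := ((hX 2 i ![0, j]).comp (u := fun x => x 0 * x 1) (by fun_prop)).integral_eq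
  simpa [Function.comp_def, add_comm] using this

lemma IsMDependent.indepFun_sum (hX : IsMDependent m X P) {F G : Finset ℕ}
    (h : ∀ i ∈ F, ∀ j ∈ G, i + m < j) :
    IndepFun (fun ω => ∑ i ∈ F, X i ω) (fun ω => ∑ i ∈ G, X i ω) P := by
  have := (hX F G (fun i hi j hj => by
    have := h i hi j hj
    rw [abs_sub_comm, abs_of_nonneg] <;> omega)).comp (φ := fun x => ∑ j, x j)
      (ψ := fun x => ∑ j, x j) (by fun_prop) (by fun_prop)
  have e : ∀ F : Finset ℕ, (fun ω => ∑ i ∈ F, X i ω) =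
      (fun x : (↥(F : Set ℕ) → ℝ) => ∑ j, x j) ∘ (fun ω (i : ↥(F : Set ℕ)) => X i ω) := fun F => by
    ext ω
    exact (Finset.sum_coe_sort F (fun i => X i ω)).symm
  rw [e F, e G]
  exact this

lemma IsMDependent.integral_mul_eq_zero (hX : IsMDependent m X P)
    (hL : ∀ i, MemLp (X i) 2 P) (h0 : ∀ i, ∫ ω, X i ω ∂P = 0) {i j : ℕ} (hij : i + m < j) :
    ∫ ω, X i ω * X j ω ∂P = 0 := by
  have := hX.indepFun_sum (F := {i}) (G := {j}) (by simpa using hij)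
  simp only [Finset.sum_singleton] at this
  rw [this.integral_fun_mul_eq_mul_integral (hL i).1 (hL j).1, h0, zero_mul]

lemma IsStationaryProcess.integral_mul_le (hst : IsStationaryProcess X P)
    (hL : ∀ i, MemLp (X i) 2 P) (i j : ℕ) :
    ∫ ω, X i ω * X j ω ∂P ≤ ∫ ω, X 0 ω ^ 2 ∂P := by
  have hs : ∀ i, ∫ ω, X i ω ^ 2 ∂P = ∫ ω, X 0 ω ^ 2 ∂P := fun i =>
    (hst.identDistrib i).sq.integral_eq
  have hi : ∀ i, Integrable (fun ω => X i ω ^ 2) P := fun i => (hL i).integrable_sq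
  calc _ ≤ ∫ ω, (X i ω ^ 2 + X j ω ^ 2) / 2 ∂P :=
        integral_mono ((hL i).integrable_mul (hL j)) (((hi i).add (hi j)).div_const 2)
          fun ω => by
            have := sq_nonneg (X i ω - X j ω)
            simp only [Pi.mul_apply]
            nlinarith
    _ = _ := by rw [integral_div, integral_add (hi i) (hi j), hs i, hs j]; ring

end MDependent

/-! ### Second moments of partial sums -/

section SecondMoment

variable {Ω : Type*} [MeasurableSpace Ω] {P : Measure Ω} {m : ℕ} {X : ℕ → Ω → ℝ}

lemma integral_sum_sq (hL : ∀ i, MemLp (X i) 2 P) (F : Finset ℕ) :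
    ∫ ω, (∑ i ∈ F, X i ω) ^ 2 ∂P = ∑ i ∈ F, ∑ j ∈ F, ∫ ω, X i ω * X j ω ∂P := by
  have hi : ∀ i j, Integrable (fun ω => X i ω * X j ω) P := fun i j =>
    (hL i).integrable_mul (hL j)
  simp_rw [sq, Finset.sum_mul_sum]
  rw [integral_finsetSum _ fun i _ => integrable_finsetSum _ fun j _ => hi i j]
  exact Finset.sum_congr rfl fun i _ => integral_finsetSum _ fun j _ => hi i j

/-- The second moment of a sum over `F` is at most linear in the size of `F`: every row of the
covariance matrix has at most `2 m + 1` nonzero entries. -/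
lemma integral_sum_sq_le (hst : IsStationaryProcess X P) (hdep : IsMDependent m X P)
    (hL : ∀ i, MemLp (X i) 2 P) (h0 : ∀ i, ∫ ω, X i ω ∂P = 0) (F : Finset ℕ) :
    ∫ ω, (∑ i ∈ F, X i ω) ^ 2 ∂P ≤ F.card * ((2 * m + 1) * ∫ ω, X 0 ω ^ 2 ∂P) := by
  rw [integral_sum_sq hL, ← nsmul_eq_mul]
  refine Finset.sum_le_card_nsmul _ _ _ fun i _ => ?_
  have hs : 0 ≤ ∫ ω, X 0 ω ^ 2 ∂P := integral_nonneg fun ω => sq_nonneg _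
  calc _ ≤ ∑ j ∈ F, if j ∈ Finset.Icc (i - m) (i + m) then ∫ ω, X 0 ω ^ 2 ∂P else 0 := by
        refine Finset.sum_le_sum fun j _ => ?_
        split_ifs with h
        · exact hst.integral_mul_le hL i j
        · rw [Finset.mem_Icc, not_and_or, not_le, not_le] at h
          rcases h with h | h
          · simp_rw [mul_comm (X i _)]
            exact (hdep.integral_mul_eq_zero hL h0 (by omega)).le
          · exact (hdep.integral_mul_eq_zero hL h0 h).le
    _ = (F.filter (· ∈ Finset.Icc (i - m) (i + m))).card * ∫ ω, X 0 ω ^ 2 ∂P := by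
        rw [← Finset.sum_filter, Finset.sum_const, nsmul_eq_mul]
    _ ≤ _ := by
        gcongr
        have : (F.filter (· ∈ Finset.Icc (i - m) (i + m))).card ≤ 2 * m + 1 :=
          (Finset.card_le_card (t := Finset.Icc (i - m) (i + m))
            fun x hx => (Finset.mem_filter.1 hx).2).trans (by rw [Nat.card_Icc]; omega)
        exact_mod_cast this

lemma integral_sum_range_succ_sq (hst : IsStationaryProcess X P) (hL : ∀ i, MemLp (X i) 2 P)
    (p : ℕ) :
    ∫ ω, (∑ i ∈ Finset.range (p + 1), X i ω) ^ 2 ∂P =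
      ∫ ω, (∑ i ∈ Finset.range p, X i ω) ^ 2 ∂P + (∫ ω, X 0 ω * X 0 ω ∂P +
        2 * ∑ j ∈ Finset.range p, ∫ ω, X 0 ω * X (j + 1) ω ∂P) := by
  have h1 : ∀ i ∈ Finset.range p, ∫ ω, X i ω * X p ω ∂P =
      ∫ ω, X 0 ω * X (p - 1 - i + 1) ω ∂P := fun i hi => by
    rw [Finset.mem_range] at hi
    rw [← hst.integral_mul_add i, show i + (p - 1 - i + 1) = p by omega]
  have h2 := hst.integral_mul_add p 0
  rw [integral_sum_sq hL, integral_sum_sq hL, Finset.sum_range_succ]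
  simp_rw [Finset.sum_range_succ, Finset.sum_add_distrib]
  simp_rw [mul_comm (X p _)]
  rw [Finset.sum_congr rfl h1,
    Finset.sum_range_reflect (fun j => ∫ ω, X 0 ω * X (j + 1) ω ∂P)]
  rw [add_zero] at h2
  rw [h2]
  ring

/-- From `m` terms on, each further term adds exactly the long-run variance to the second moment of
the partial sum, because it sees the whole range of lags `1, …, m` in its past. -/
lemma integral_sum_range_add_sq (hst : IsStationaryProcess X P) (hdep : IsMDependent m X P)
    (hL : ∀ i, MemLp (X i) 2 P) (h0 : ∀ i, ∫ ω, X i ω ∂P = 0) (k : ℕ) :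
    ∫ ω, (∑ i ∈ Finset.range (m + k), X i ω) ^ 2 ∂P =
      ∫ ω, (∑ i ∈ Finset.range m, X i ω) ^ 2 ∂P + k * (∫ ω, X 0 ω * X 0 ω ∂P +
        2 * ∑ j ∈ Finset.range m, ∫ ω, X 0 ω * X (j + 1) ω ∂P) := by
  induction k with
  | zero => simp
  | succ k ih =>
    rw [← add_assoc, integral_sum_range_succ_sq hst hL, ih, Finset.sum_range_add,
      Finset.sum_eq_zero (s := Finset.range k) fun j _ =>
        hdep.integral_mul_eq_zero hL h0 (by omega)]
    push_cast
    ring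

end SecondMoment

/-! ### Decomposition into blocks -/

section Blocks

/-- The union of the first `k` blocks `[j * q, j * q + p)` of length `p`, spaced `q` apart. -/
def blockUnion (p q k : ℕ) : Finset ℕ :=
  (Finset.range k).biUnion fun j => Finset.Ico (j * q) (j * q + p)

lemma mem_blockUnion_add_lt {p q k i : ℕ} (hi : i ∈ blockUnion p q k) : i + q < k * q + p := by
  simp only [blockUnion, Finset.mem_biUnion, Finset.mem_range, Finset.mem_Ico] at hi
  obtain ⟨j, hj, -, h⟩ := hi
  have := Nat.mul_le_mul_right q (Nat.succ_le_of_lt hj)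
  rw [Nat.succ_mul] at this
  omega

lemma sum_blockUnion_succ {p q : ℕ} (hpq : p ≤ q) (k : ℕ) (f : ℕ → ℝ) :
    ∑ i ∈ blockUnion p q (k + 1), f i =
      ∑ i ∈ blockUnion p q k, f i + ∑ i ∈ Finset.Ico (k * q) (k * q + p), f i := by
  have : Disjoint (blockUnion p q k) (Finset.Ico (k * q) (k * q + p)) := by
    rw [Finset.disjoint_left]
    intro i hi hi'
    have := mem_blockUnion_add_lt hi
    rw [Finset.mem_Ico] at hi'
    omega
  rw [← Finset.sum_union this]
  congr 1
  rw [blockUnion, Finset.range_add_one, Finset.biUnion_insert, Finset.union_comm]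
  rfl

lemma card_blockUnion {p q : ℕ} (hpq : p ≤ q) (k : ℕ) : (blockUnion p q k).card = k * p := by
  induction k with
  | zero => simp [blockUnion]
  | succ k ih =>
    have := sum_blockUnion_succ hpq k (fun _ => 1)
    simp only [Finset.sum_const, nsmul_eq_mul, mul_one, Nat.card_Ico, ih] at this
    rw [add_tsub_cancel_left] at this
    rw [Nat.succ_mul]
    exact_mod_cast this

lemma blockUnion_subset_range {p q : ℕ} (hpq : p ≤ q) (n : ℕ) :
    blockUnion p q (n / q) ⊆ Finset.range n := fun i hi => by
  have := mem_blockUnion_add_lt hi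
  have := Nat.div_mul_le_self n q
  rw [Finset.mem_range]
  omega

/-- Outside the blocks there are only the `n / (p + m)` gaps of length `m` and one incomplete
period at the end. -/
lemma card_range_sdiff_blockUnion_le (p m n : ℕ) (hq : 0 < p + m) :
    (Finset.range n \ blockUnion p (p + m) (n / (p + m))).card ≤
      n / (p + m) * m + (p + m) := by
  rw [Finset.card_sdiff_of_subset (blockUnion_subset_range (by omega) n), Finset.card_range,
    card_blockUnion (by omega)]
  have h1 := Nat.div_add_mod n (p + m)
  have h2 := Nat.mod_lt n hq
  rw [mul_comm, mul_add] at h1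
  omega

end Blocks

/-! ### The central limit theorem for stationary `m`-dependent sequences -/

section CLT

variable {Ω : Type*} [MeasurableSpace Ω] {P : Measure Ω} [IsProbabilityMeasure P] {m : ℕ}
  {X : ℕ → Ω → ℝ}

/-- Blocks separated by gaps of length `m` have i.i.d. sums. -/
lemma charFun_map_sum_blockUnion (hst : IsStationaryProcess X P) (hdep : IsMDependent m X P)
    (hmeas : ∀ i, AEMeasurable (X i) P) (p k : ℕ) :
    charFun (P.map (fun ω => ∑ i ∈ blockUnion p (p + m) k, X i ω)) =
      charFun (P.map (fun ω => ∑ i ∈ Finset.range p, X i ω)) ^ k := by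
  induction k with
  | zero => ext t; simp [blockUnion, charFun_dirac]
  | succ k ih =>
    have hid := hst.identDistrib_sum (k * (p + m)) p
    have hind : IndepFun (fun ω => ∑ i ∈ blockUnion p (p + m) k, X i ω)
        (fun ω => ∑ i ∈ Finset.Ico (k * (p + m)) (k * (p + m) + p), X i ω) P :=
      hdep.indepFun_sum fun i hi j hj => by
        have := mem_blockUnion_add_lt hi
        rw [Finset.mem_Ico] at hj
        omega
    simp_rw [sum_blockUnion_succ (Nat.le_add_right p m)]
    rw [hind.charFun_map_fun_add_eq_mul (Finset.aemeasurable_fun_sum _ fun _ _ => hmeas _)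
      (Finset.aemeasurable_fun_sum _ fun _ _ => hmeas _), ih, pow_succ]
    simp_rw [Finset.sum_Ico_eq_sum_range, add_tsub_cancel_left]
    rw [hid.map_eq]

/-- The limit in the classical central limit theorem, for an arbitrary positive variance. -/
lemma tendsto_charFun_inv_sqrt_mul_pow_of_variance {U : Ω → ℝ} (hU : MemLp U 2 P)
    (h0 : ∫ ω, U ω ∂P = 0) (hpos : 0 < ∫ ω, U ω ^ 2 ∂P) (t : ℝ) :
    Tendsto (fun k : ℕ => charFun (P.map U) ((√k)⁻¹ * t) ^ k) atTop
      (𝓝 (Complex.exp (-((∫ ω, U ω ^ 2 ∂P) * t ^ 2 / 2 : ℝ)))) := by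
  set v := ∫ ω, U ω ^ 2 ∂P with hv
  have hs : √v ≠ 0 := (Real.sqrt_pos.2 hpos).ne'
  have := tendsto_charFun_inv_sqrt_mul_pow (X := fun ω => (√v)⁻¹ * U ω)
    (hU.aemeasurable.const_mul _) (by rw [integral_const_mul, h0, mul_zero])
    (by
      simp only [Pi.pow_apply, mul_pow]
      rw [integral_const_mul, ← hv, inv_pow, Real.sq_sqrt hpos.le, inv_mul_cancel₀ hpos.ne'])
    (√v * t)
  have e : Complex.exp (-((√v * t : ℝ) : ℂ) ^ 2 / 2) = Complex.exp (-(v * t ^ 2 / 2 : ℝ)) := by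
    rw [← Complex.ofReal_pow, mul_pow, Real.sq_sqrt hpos.le]
    push_cast
    ring_nf
  rw [e] at this
  refine this.congr fun k => ?_
  rw [charFun_map_mul_comp hU.aemeasurable]
  congr 2
  field_simp

/-- For a fixed block length `p`, the normalised sum over the complete blocks below `n` is
asymptotically normal, with variance that of one block divided by the period `p + m`. -/
lemma tendsto_charFun_blockUnion (hst : IsStationaryProcess X P) (hdep : IsMDependent m X P)
    (hL : ∀ i, MemLp (X i) 2 P) (h0 : ∀ i, ∫ ω, X i ω ∂P = 0) {p : ℕ}
    (hpos : 0 < ∫ ω, (∑ i ∈ Finset.range p, X i ω) ^ 2 ∂P) (hq : 0 < p + m) (t : ℝ) :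
    Tendsto (fun n : ℕ => charFun (P.map (fun ω =>
      (√n)⁻¹ * ∑ i ∈ blockUnion p (p + m) (n / (p + m)), X i ω)) t) atTop
      (𝓝 (Complex.exp (-((∫ ω, (∑ i ∈ Finset.range p, X i ω) ^ 2 ∂P) / (p + m : ℕ)
        * t ^ 2 / 2 : ℝ)))) := by
  set q := p + m with hqdef
  set v := ∫ ω, (∑ i ∈ Finset.range p, X i ω) ^ 2 ∂P
  have hq0 : (0 : ℝ) < q := by exact_mod_cast hq
  have hT : ∀ F : Finset ℕ, MemLp (fun ω => ∑ i ∈ F, X i ω) 2 P := fun F =>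
    memLp_finsetSum _ fun i _ => hL i
  have hk : Tendsto (fun n : ℕ => n / q) atTop atTop := Nat.tendsto_div_const_atTop hq.ne'
  have hc : Tendsto (fun n : ℕ => √((n / q : ℕ) / (n : ℝ))) atTop (𝓝 √(1 / q)) := by
    refine (Real.continuous_sqrt.tendsto _).comp ?_
    have := (tendsto_nat_floor_mul_div_atTop (R := ℝ) (a := 1 / q) (by positivity)).comp
      tendsto_natCast_atTop_atTop
    refine this.congr fun n => ?_
    simp only [Function.comp]
    rw [one_div, inv_mul_eq_div, Nat.floor_div_eq_div]
  have := tendsto_charFun_const_mul (P := P) (t := t) (v := v) (c₀ := √(1 / q))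
    (A := fun n ω => (√(n / q : ℕ))⁻¹ * ∑ i ∈ blockUnion p q (n / q), X i ω)
    (C := p * ((2 * m + 1) * ∫ ω, X 0 ω ^ 2 ∂P)) (fun n => (hT _).const_mul _) (fun n => ?_) hc
    (fun t => ?_)
  · rw [Real.sq_sqrt (by positivity), mul_one_div] at this
    refine this.congr fun n => ?_
    congr 3
    ext ω
    -- For `n / q = 0` the sum is empty, and the junk value `0⁻¹ = 0` is harmless.
    rcases Nat.eq_zero_or_pos (n / q) with h | h
    · simp [h, blockUnion]
    · have : (0 : ℝ) < √(n / q : ℕ) := Real.sqrt_pos.2 (by exact_mod_cast h)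
      rw [Real.sqrt_div (by positivity)]
      field_simp
  · simp_rw [mul_pow]
    rw [integral_const_mul]
    have h1 := integral_sum_sq_le hst hdep hL h0 (blockUnion p q (n / q))
    rw [card_blockUnion (by omega)] at h1
    have hs : 0 ≤ ∫ ω, X 0 ω ^ 2 ∂P := integral_nonneg fun ω => sq_nonneg _
    rw [inv_pow, Real.sq_sqrt (by positivity)]
    rcases Nat.eq_zero_or_pos (n / q) with h | h
    · rw [h]
      simp only [Nat.cast_zero, inv_zero, zero_mul]
      positivity
    · have h' : (0 : ℝ) < (n / q : ℕ) := by exact_mod_cast h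
      rw [inv_mul_le_iff₀ h']
      push_cast at h1 ⊢
      linarith
  · refine ((tendsto_charFun_inv_sqrt_mul_pow_of_variance (hT (Finset.range p)) ?_ hpos t).comp
      hk).congr fun n => ?_
    · rw [integral_finsetSum _ fun i _ => (hL i).integrable one_le_two]
      exact Finset.sum_eq_zero fun i _ => h0 i
    · simp only [Function.comp]
      rw [charFun_map_mul_comp (hT _).aemeasurable,
        charFun_map_sum_blockUnion hst hdep fun i => (hL i).aemeasurable]
      rfl

/-- The central limit theorem for centred stationary `m`-dependent sequences with positive long-run
variance `v`. -/
lemma tendsto_charFun_inv_sqrt_mul_sum (hst : IsStationaryProcess X P) (hdep : IsMDependent m X P)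
    (hL : ∀ i, MemLp (X i) 2 P) (h0 : ∀ i, ∫ ω, X i ω ∂P = 0) {v : ℝ}
    (hv : v = ∫ ω, X 0 ω * X 0 ω ∂P + 2 * ∑ j ∈ Finset.range m, ∫ ω, X 0 ω * X (j + 1) ω ∂P)
    (hpos : 0 < v) (t : ℝ) :
    Tendsto (fun n : ℕ => charFun (P.map (fun ω =>
      (√n)⁻¹ * ∑ i ∈ Finset.range n, X i ω)) t) atTop
      (𝓝 (Complex.exp (-(v * t ^ 2 / 2 : ℝ)))) := by
  have hT : ∀ F : Finset ℕ, MemLp (fun ω => ∑ i ∈ F, X i ω) 2 P := fun F =>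
    memLp_finsetSum _ fun i _ => hL i
  have hV : ∀ k : ℕ, ∫ ω, (∑ i ∈ Finset.range (m + k), X i ω) ^ 2 ∂P =
      ∫ ω, (∑ i ∈ Finset.range m, X i ω) ^ 2 ∂P + k * v := fun k => by
    rw [integral_sum_range_add_sq hst hdep hL h0, hv]
  set v₀ := ∫ ω, (∑ i ∈ Finset.range m, X i ω) ^ 2 ∂P
  have hv₀ : 0 ≤ v₀ := integral_nonneg fun ω => sq_nonneg _
  set s := (2 * m + 1) * ∫ ω, X 0 ω ^ 2 ∂P with hs
  have hs0 : 0 ≤ s := mul_nonneg (by positivity) (integral_nonneg fun ω => sq_nonneg _)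
  have hinv : Tendsto (fun k : ℕ => ((m + (k + 1) + m : ℕ) : ℝ)⁻¹) atTop (𝓝 0) :=
    tendsto_inv_atTop_zero.comp (tendsto_natCast_atTop_atTop.comp
      (tendsto_atTop_mono (fun k => by omega : ∀ k, k ≤ m + (k + 1) + m) tendsto_id))
  -- Blocks of length `m + (k + 1)`: at least `m`, for the affine formula for the second moment, and
  -- positive even if `m = 0`.
  refine tendsto_of_approx
    (g := fun k n => charFun (P.map (fun ω =>
      (√n)⁻¹ * ∑ i ∈ blockUnion (m + (k + 1)) (m + (k + 1) + m) (n / (m + (k + 1) + m)), X i ω)) t)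
    (L := fun k => Complex.exp (-((v₀ + (k + 1 : ℕ) * v) / (m + (k + 1) + m : ℕ) * t ^ 2 / 2 : ℝ)))
    (e := fun k n =>
      |t| * √((((m + (k + 1) + m : ℕ) : ℝ)⁻¹ * m + (m + (k + 1) + m : ℕ) * (n : ℝ)⁻¹) * s))
    (e' := fun k => |t| * √((((m + (k + 1) + m : ℕ) : ℝ)⁻¹ * m + (m + (k + 1) + m : ℕ) * 0) * s))
    ?_ ?_ (fun k n => ?_) (fun k => ?_) ?_
  · refine .of_forall fun k => ?_
    have := tendsto_charFun_blockUnion hst hdep hL h0 (p := m + (k + 1)) (by rw [hV]; positivity)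
      (by omega) t
    rwa [hV] at this
  · have h1 : Tendsto (fun k : ℕ => (v₀ + (k + 1 : ℕ) * v) / (m + (k + 1) + m : ℕ)) atTop
        (𝓝 v) := by
      have : Tendsto (fun k : ℕ => v + (v₀ - 2 * m * v) * ((m + (k + 1) + m : ℕ) : ℝ)⁻¹) atTop
          (𝓝 (v + (v₀ - 2 * m * v) * 0)) := (hinv.const_mul _).const_add _
      rw [mul_zero, add_zero] at this
      refine this.congr fun k => ?_
      have : (((m + (k + 1) + m : ℕ) : ℝ)) ≠ 0 := by
        have : m + (k + 1) + m ≠ 0 := by omega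
        exact_mod_cast this
      field_simp
      push_cast
      ring
    have hcont : Continuous fun x : ℝ => Complex.exp (-(x * t ^ 2 / 2 : ℝ)) := by fun_prop
    exact (hcont.tendsto v).comp h1
  · set q := m + (k + 1) + m with hq
    set B := blockUnion (m + (k + 1)) q (n / q)
    have hB : B ⊆ Finset.range n := blockUnion_subset_range (by omega) n
    have hd : ∀ ω, (√n)⁻¹ * ∑ i ∈ Finset.range n, X i ω - (√n)⁻¹ * ∑ i ∈ B, X i ω =
        (√n)⁻¹ * ∑ i ∈ Finset.range n \ B, X i ω := fun ω => by
      rw [← Finset.sum_sdiff hB]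
      ring
    refine (norm_charFun_map_sub_le ((hT _).const_mul _).aemeasurable
      ((hT _).const_mul _).aemeasurable (((hT _).const_mul _).sub ((hT _).const_mul _)) t).trans ?_
    gcongr
    simp_rw [hd, mul_pow]
    rw [integral_const_mul, inv_pow, Real.sq_sqrt (by positivity)]
    rcases Nat.eq_zero_or_pos n with rfl | hn
    · simp only [Nat.cast_zero, inv_zero, zero_mul]
      positivity
    have hq0 : 0 < q := by omega
    have hn' : (0 : ℝ) < n := by exact_mod_cast hn
    have hq' : (0 : ℝ) < q := by exact_mod_cast hq0
    have hcard : ((Finset.range n \ B).card : ℝ) ≤ n / q * m + q := by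
      have h1 : ((Finset.range n \ B).card : ℝ) ≤ (n / q : ℕ) * m + q := by
        exact_mod_cast card_range_sdiff_blockUnion_le (m + (k + 1)) m n hq0
      refine h1.trans ?_
      gcongr
      exact Nat.cast_div_le
    rw [inv_mul_le_iff₀ hn']
    calc _ ≤ (Finset.range n \ B).card * s := integral_sum_sq_le hst hdep hL h0 _
      _ ≤ (n / q * m + q) * s := by gcongr
      _ = _ := by field_simp
  · refine Tendsto.const_mul _ ((Real.continuous_sqrt.tendsto _).comp ?_)
    exact ((tendsto_inv_atTop_nhds_zero_nat.const_mul _).const_add _).mul_const _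
  · have : Tendsto (fun k : ℕ => |t| * √((((m + (k + 1) + m : ℕ) : ℝ)⁻¹ * m + 0) * s)) atTop
        (𝓝 (|t| * √((0 * m + 0) * s))) := by
      refine Tendsto.const_mul _ ((Real.continuous_sqrt.tendsto _).comp ?_)
      exact ((hinv.mul_const _).add_const _).mul_const _
    simpa using this

end CLT

/-! ### The random index -/

section RandomIndex

variable {Ω : Type*} [MeasurableSpace Ω] {P : Measure Ω} {m : ℕ}

lemma measurable_sum_range_uncurry :
    Measurable fun z : (ℕ → ℝ) × ℕ => ∑ i ∈ Finset.range z.2, z.1 i :=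
  measurable_from_prod_countable_left fun n => by dsimp only; fun_prop

lemma measurable_sum_range_random {X : ℕ → Ω → ℝ} {N : Ω → ℕ} (hX : ∀ i, Measurable (X i))
    (hN : Measurable N) : Measurable fun ω => ∑ i ∈ Finset.range (N ω), X i ω :=
  measurable_sum_range_uncurry.comp ((measurable_pi_lambda _ hX).prodMk hN)

lemma measurable_randomIndex {Y : ℕ → Ω → ℕ} (hY : ∀ i, Measurable (Y i)) (n : ℕ) :
    Measurable (randomIndex Y n) :=
  Finset.measurable_fun_sum _ fun i _ => hY i

lemma integral_sum_range_sub_sq_le {X : ℕ → Ω → ℝ} (hst : IsStationaryProcess X P)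
    (hdep : IsMDependent m X P) (hL : ∀ i, MemLp (X i) 2 P) (h0 : ∀ i, ∫ ω, X i ω ∂P = 0)
    (n k : ℕ) :
    ∫ ω, (∑ i ∈ Finset.range n, X i ω - ∑ i ∈ Finset.range k, X i ω) ^ 2 ∂P ≤
      |(n : ℝ) - k| * ((2 * m + 1) * ∫ ω, X 0 ω ^ 2 ∂P) := by
  wlog h : k ≤ n generalizing n k
  · rw [abs_sub_comm]
    simp_rw [fun ω => sub_sq_comm (∑ i ∈ Finset.range n, X i ω) (∑ i ∈ Finset.range k, X i ω)]
    exact this k n (not_le.1 h).le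
  · have h1 := integral_sum_sq_le hst hdep hL h0 (Finset.Ico k n)
    simp_rw [Finset.sum_Ico_eq_sub _ h, Nat.card_Ico, Nat.cast_sub h] at h1
    rwa [abs_of_nonneg (by rw [sub_nonneg]; exact_mod_cast h)]

variable [IsProbabilityMeasure P]

/-- If the increments of the partial sums have second moments at most linear in their length, the
same holds for an independent random endpoint, by integrating out the process first. -/
lemma memLp_and_integral_sum_range_random_sub_sq_le {X : ℕ → Ω → ℝ} {N : Ω → ℕ}
    (hX : ∀ i, Measurable (X i)) (hN : Measurable N)
    (hXN : IndepFun (fun ω i => X i ω) N P) (hL : ∀ i, MemLp (X i) 2 P) {k : ℕ} {C : ℝ}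
    (hC : ∀ n : ℕ, ∫ ω, (∑ i ∈ Finset.range n, X i ω - ∑ i ∈ Finset.range k, X i ω) ^ 2 ∂P ≤
      |(n : ℝ) - k| * C)
    (hint : Integrable (fun ω => |(N ω : ℝ) - k|) P) :
    MemLp (fun ω => ∑ i ∈ Finset.range (N ω), X i ω - ∑ i ∈ Finset.range k, X i ω) 2 P ∧
    ∫ ω, (∑ i ∈ Finset.range (N ω), X i ω - ∑ i ∈ Finset.range k, X i ω) ^ 2 ∂P ≤
      (∫ ω, |(N ω : ℝ) - k| ∂P) * C := by
  have hXm : Measurable fun ω i => X i ω := measurable_pi_lambda _ hX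
  have hprod := (indepFun_iff_map_prod_eq_prod_map_map hXm.aemeasurable hN.aemeasurable).1 hXN
  have := Measure.isProbabilityMeasure_map (μ := P) hXm.aemeasurable
  have := Measure.isProbabilityMeasure_map (μ := P) hN.aemeasurable
  set f : (ℕ → ℝ) × ℕ → ℝ := fun z =>
    (∑ i ∈ Finset.range z.2, z.1 i - ∑ i ∈ Finset.range k, z.1 i) ^ 2 with hf
  have hfm : Measurable f := (measurable_sum_range_uncurry.sub (by fun_prop)).pow_const 2
  have hfn : ∀ n, Measurable fun x => f (x, n) := fun n => hfm.comp (by fun_prop)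
  have hinner : ∀ n, ∫ x, f (x, n) ∂(P.map fun ω i => X i ω) ≤ |(n : ℝ) - k| * C := fun n => by
    rw [integral_map hXm.aemeasurable (hfn n).aestronglyMeasurable]
    exact hC n
  have hintN : Integrable (fun n : ℕ => |(n : ℝ) - k| * C) (P.map N) :=
    ((integrable_map_measure (f := N) (g := fun n : ℕ => |(n : ℝ) - k|)
      measurable_from_nat.aestronglyMeasurable hN.aemeasurable).2 hint).mul_const C
  have hsq : ∀ n : ℕ, Integrable
      (fun ω => (∑ i ∈ Finset.range n, X i ω - ∑ i ∈ Finset.range k, X i ω) ^ 2) P := fun n =>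
    MemLp.integrable_sq (f := fun ω => ∑ i ∈ Finset.range n, X i ω - ∑ i ∈ Finset.range k, X i ω)
      ((memLp_finsetSum _ fun i _ => hL i).sub (memLp_finsetSum _ fun i _ => hL i))
  have hfi : Integrable f ((P.map fun ω i => X i ω).prod (P.map N)) := by
    refine (integrable_prod_iff' hfm.aestronglyMeasurable).2 ⟨.of_forall fun n => ?_, ?_⟩
    · exact (integrable_map_measure (hfn n).aestronglyMeasurable hXm.aemeasurable).2 (hsq n)
    · refine hintN.mono' measurable_from_nat.aestronglyMeasurable (.of_forall fun n => ?_)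
      have : ∀ x, ‖f (x, n)‖ = f (x, n) := fun x => Real.norm_of_nonneg (sq_nonneg _)
      simp_rw [this]
      rw [Real.norm_of_nonneg (integral_nonneg fun x => sq_nonneg _)]
      exact hinner n
  have hpair : AEMeasurable (fun ω => ((fun i => X i ω), N ω)) P :=
    (hXm.prodMk hN).aemeasurable
  refine ⟨(memLp_two_iff_integrable_sq ?_).2 ?_, ?_⟩
  · exact ((measurable_sum_range_random hX hN).sub (by fun_prop)).aestronglyMeasurable
  · rw [← hprod, integrable_map_measure hfm.aestronglyMeasurable hpair] at hfi
    exact hfi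
  · calc _ = ∫ z, f z ∂(P.map fun ω => ((fun i => X i ω), N ω)) :=
          (integral_map hpair hfm.aestronglyMeasurable).symm
      _ = ∫ n, ∫ x, f (x, n) ∂(P.map fun ω i => X i ω) ∂(P.map N) := by
          rw [hprod, integral_prod_symm _ hfi]
      _ ≤ ∫ n, |(n : ℝ) - k| * C ∂(P.map N) :=
          integral_mono hfi.integral_prod_right hintN hinner
      _ = _ := by
          rw [integral_map hN.aemeasurable measurable_from_nat.aestronglyMeasurable,
            integral_mul_const]

variable {Y : ℕ → Ω → ℕ}

/-- `N_n - n ν` is square integrable, with second moment `n` times the variance of `Y 0`. -/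
lemma memLp_and_integral_randomIndex_sub_sq
    (hYindep : iIndepFun Y P) (hYident : ∀ i, IdentDistrib (Y i) (Y 0) P P)
    (hL : MemLp (fun ω => (Y 0 ω : ℝ)) 2 P) (n : ℕ) :
    MemLp (fun ω => (randomIndex Y n ω : ℝ) - n * ∫ ω, (Y 0 ω : ℝ) ∂P) 2 P ∧
    ∫ ω, ((randomIndex Y n ω : ℝ) - n * ∫ ω, (Y 0 ω : ℝ) ∂P) ^ 2 ∂P =
      n * Var[fun ω => (Y 0 ω : ℝ); P] := by
  have hid : ∀ i, IdentDistrib (fun ω => (Y i ω : ℝ)) (fun ω => (Y 0 ω : ℝ)) P P := fun i =>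
    (hYident i).comp (u := fun y : ℕ => (y : ℝ)) measurable_from_nat
  have hind : iIndepFun (fun i ω => (Y i ω : ℝ)) P :=
    hYindep.comp (fun _ (y : ℕ) => (y : ℝ)) fun _ => measurable_from_nat
  have hLi : ∀ i, MemLp (fun ω => (Y i ω : ℝ)) 2 P := fun i => (hid i).memLp_iff.2 hL
  have hN : (fun ω => (randomIndex Y n ω : ℝ)) = ∑ i ∈ Finset.range n, fun ω => (Y i ω : ℝ) := by
    ext ω
    simp [randomIndex]
  have hLN : MemLp (fun ω => (randomIndex Y n ω : ℝ)) 2 P := by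
    rw [hN]
    exact memLp_finsetSum' _ fun i _ => hLi i
  have hmean : ∫ ω, (randomIndex Y n ω : ℝ) ∂P = n * ∫ ω, (Y 0 ω : ℝ) ∂P := by
    simp only [randomIndex, Nat.cast_sum]
    rw [integral_finsetSum _ fun i _ => (hLi i).integrable one_le_two]
    simp [fun i => (hid i).integral_eq]
  refine ⟨hLN.sub (memLp_const _), ?_⟩
  rw [← hmean, ← variance_eq_integral hLN.aemeasurable, hN,
    IndepFun.variance_sum (fun i _ => hLi i) fun i _ j _ hij => hind.indepFun hij]
  simp [fun i => (hid i).variance_eq]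

lemma tendsto_charFun_randomIndex
    (hYindep : iIndepFun Y P) (hYident : ∀ i, IdentDistrib (Y i) (Y 0) P P)
    (hL : MemLp (fun ω => (Y 0 ω : ℝ)) 2 P) (t : ℝ) :
    Tendsto (fun n : ℕ => charFun (P.map fun ω =>
      (√n)⁻¹ * ((randomIndex Y n ω : ℝ) - n * ∫ ω, (Y 0 ω : ℝ) ∂P)) t) atTop
      (𝓝 (Complex.exp (-(Var[fun ω => (Y 0 ω : ℝ); P] * t ^ 2 / 2 : ℝ)))) := by
  have h := tendstoInDistribution_inv_sqrt_mul_sum_sub (P := P)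
    (P' := gaussianReal 0 Var[fun ω => (Y 0 ω : ℝ); P].toNNReal) (X := fun i ω => (Y i ω : ℝ))
    (Y := id) ⟨aemeasurable_id, Measure.map_id⟩ hL
    (hYindep.comp (fun _ (y : ℕ) => (y : ℝ)) fun _ => measurable_from_nat)
    fun i => (hYident i).comp (u := fun y : ℕ => (y : ℝ)) measurable_from_nat
  have h' := ProbabilityMeasure.tendsto_iff_tendsto_charFun.1 h.tendsto t
  simp only [ProbabilityMeasure.coe_mk, Measure.map_id, charFun_gaussianReal] at h'
  convert h' using 3
  · simp [randomIndex]
  · rw [Real.coe_toNNReal _ (variance_nonneg _ _)]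
    push_cast
    ring

end RandomIndex

/-! ### Random sums -/

section RandomSum

variable {Ω : Type*} [MeasurableSpace Ω] {P : Measure Ω} [IsProbabilityMeasure P] {m : ℕ}

/-- The central limit theorem for random sums of a centred sequence, to which the fluctuation of the
random index, weighted by `μ`, is added. -/
lemma tendsto_charFun_random_sum {X : ℕ → Ω → ℝ} {Y : ℕ → Ω → ℕ}
    (hX : ∀ i, Measurable (X i)) (hY : ∀ i, Measurable (Y i))
    (hst : IsStationaryProcess X P) (hdep : IsMDependent m X P)
    (hL : ∀ i, MemLp (X i) 2 P) (h0 : ∀ i, ∫ ω, X i ω ∂P = 0)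
    (hYindep : iIndepFun Y P) (hYident : ∀ i, IdentDistrib (Y i) (Y 0) P P)
    (hYL : MemLp (fun ω => (Y 0 ω : ℝ)) 2 P)
    (hXY : IndepFun (fun ω i => X i ω) (fun ω i => Y i ω) P) {v ν μ : ℝ}
    (hv : v = ∫ ω, X 0 ω * X 0 ω ∂P + 2 * ∑ j ∈ Finset.range m, ∫ ω, X 0 ω * X (j + 1) ω ∂P)
    (hpos : 0 < v) (hν : ν = ∫ ω, (Y 0 ω : ℝ) ∂P) (hνpos : 0 < ν) (t : ℝ) :
    Tendsto (fun n : ℕ => charFun (P.map fun ω => (√n)⁻¹ *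
      (∑ i ∈ Finset.range (randomIndex Y n ω), X i ω + μ * (randomIndex Y n ω - n * ν))) t) atTop
      (𝓝 (Complex.exp (-((ν * v + Var[fun ω => (Y 0 ω : ℝ); P] * μ ^ 2) * t ^ 2 / 2 : ℝ)))) := by
  set w := Var[fun ω => (Y 0 ω : ℝ); P]
  have hw : 0 ≤ w := variance_nonneg _ _
  set C := (2 * m + 1) * ∫ ω, X 0 ω ^ 2 ∂P with hC
  have hC0 : 0 ≤ C := mul_nonneg (by positivity) (integral_nonneg fun ω => sq_nonneg _)
  set k : ℕ → ℕ := fun n => ⌊ν * n⌋₊ with hk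
  have hT : ∀ F : Finset ℕ, MemLp (fun ω => ∑ i ∈ F, X i ω) 2 P := fun F =>
    memLp_finsetSum _ fun i _ => hL i
  have hNm := measurable_randomIndex hY
  have hNc : ∀ n, Measurable fun ω => (randomIndex Y n ω : ℝ) := fun n =>
    measurable_from_nat.comp (hNm n)
  have hXN : ∀ n : ℕ, IndepFun (fun ω i => X i ω) (randomIndex Y n) P := fun n =>
    hXY.comp (φ := id) (ψ := fun y : ℕ → ℕ => ∑ i ∈ Finset.range n, y i) measurable_id (by fun_prop)
  have hNL := fun n => memLp_and_integral_randomIndex_sub_sq hYindep hYident hYL n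
  rw [← hν] at hNL
  -- The sum over the deterministic index `⌊ν n⌋`.
  have hkt : Tendsto k atTop atTop :=
    (tendsto_nat_floor_atTop (α := ℝ)).comp
      (tendsto_natCast_atTop_atTop.const_mul_atTop hνpos)
  have hc : Tendsto (fun n : ℕ => √(k n / (n : ℝ))) atTop (𝓝 √ν) :=
    (Real.continuous_sqrt.tendsto _).comp ((tendsto_nat_floor_mul_div_atTop hνpos.le).comp
      tendsto_natCast_atTop_atTop)
  have hS : Tendsto (fun n : ℕ => charFun (P.map fun ω =>
      (√n)⁻¹ * ∑ i ∈ Finset.range (k n), X i ω) t) atTop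
      (𝓝 (Complex.exp (-(v * ν * t ^ 2 / 2 : ℝ)))) := by
    have := tendsto_charFun_const_mul (P := P) (t := t) (v := v) (c₀ := √ν)
      (A := fun n ω => (√(k n))⁻¹ * ∑ i ∈ Finset.range (k n), X i ω) (C := C)
      (fun n => (hT _).const_mul _) (fun n => ?_) hc
      (fun t => (tendsto_charFun_inv_sqrt_mul_sum hst hdep hL h0 hv hpos t).comp hkt)
    · rw [Real.sq_sqrt hνpos.le] at this
      refine this.congr fun n => ?_
      congr 3
      ext ω
      -- For `k n = 0` the sum is empty, and the junk value `0⁻¹ = 0` is harmless.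
      rcases Nat.eq_zero_or_pos (k n) with h | h
      · simp [h]
      · have : (0 : ℝ) < √(k n) := Real.sqrt_pos.2 (by exact_mod_cast h)
        rw [Real.sqrt_div (by positivity)]
        field_simp
    · simp_rw [mul_pow]
      rw [integral_const_mul, inv_pow, Real.sq_sqrt (by positivity)]
      have h1 := integral_sum_sq_le hst hdep hL h0 (Finset.range (k n))
      rw [Finset.card_range] at h1
      rcases Nat.eq_zero_or_pos (k n) with h | h
      · rw [h]
        simpa using hC0
      · rwa [inv_mul_le_iff₀ (by exact_mod_cast h)]
  -- The two summands of the approximating variable are independent.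
  have hN := (tendsto_charFun_randomIndex hYindep hYident hYL (μ * t))
  rw [← hν] at hN
  have hB := hS.mul hN
  rw [← Complex.exp_add] at hB
  have hlim : -((v * ν * t ^ 2 / 2 : ℝ) : ℂ) + -((w * (μ * t) ^ 2 / 2 : ℝ) : ℂ) =
      -(((ν * v + w * μ ^ 2) * t ^ 2 / 2 : ℝ) : ℂ) := by
    push_cast
    ring
  rw [hlim] at hB
  have hBm : ∀ n : ℕ, AEMeasurable (fun ω => μ * ((√n)⁻¹ * ((randomIndex Y n ω : ℝ) - n * ν))) P :=
    fun n => (((hNL n).1.const_mul _).const_mul _).aemeasurable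
  have hSm : ∀ n : ℕ, AEMeasurable (fun ω => (√n)⁻¹ * ∑ i ∈ Finset.range (k n), X i ω) P :=
    fun n => ((hT _).const_mul _).aemeasurable
  have hB' : Tendsto (fun n : ℕ => charFun (P.map fun ω =>
      (√n)⁻¹ * ∑ i ∈ Finset.range (k n), X i ω +
        μ * ((√n)⁻¹ * ((randomIndex Y n ω : ℝ) - n * ν))) t) atTop
      (𝓝 (Complex.exp (-((ν * v + w * μ ^ 2) * t ^ 2 / 2 : ℝ)))) := by
    refine hB.congr fun n => ?_
    have hind : IndepFun (fun ω => (√n)⁻¹ * ∑ i ∈ Finset.range (k n), X i ω)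
        (fun ω => μ * ((√n)⁻¹ * ((randomIndex Y n ω : ℝ) - n * ν))) P := by
      have h1 : Measurable fun x : ℕ → ℝ => (√n)⁻¹ * ∑ i ∈ Finset.range (k n), x i := by fun_prop
      have h2 : Measurable fun N : ℕ => μ * ((√n)⁻¹ * ((N : ℝ) - n * ν)) := measurable_from_nat
      exact (hXN n).comp h1 h2
    rw [hind.charFun_map_fun_add_eq_mul (hSm n) (hBm n), Pi.mul_apply,
      charFun_map_mul_comp (((hNL n).1.const_mul _).aemeasurable) μ t]
  -- Replacing `⌊ν n⌋` by the random index is negligible in `L²`.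
  have hNk : ∀ n, Integrable (fun ω => |(randomIndex Y n ω : ℝ) - k n|) P ∧
      ∫ ω, |(randomIndex Y n ω : ℝ) - k n| ∂P ≤ √(n * w) + 1 := fun n => by
    have hle : ∀ ω, |(randomIndex Y n ω : ℝ) - k n| ≤ |(randomIndex Y n ω : ℝ) - n * ν| + 1 :=
      fun ω => by
        have h1 := Nat.floor_le (show 0 ≤ ν * n by positivity)
        have h2 := Nat.lt_floor_add_one (ν * n)
        have h3 : |(n : ℝ) * ν - k n| ≤ 1 := by
          rw [abs_le]
          constructor <;> simp only [hk] <;> linarith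
        exact (abs_sub_le _ (n * ν) _).trans (by linarith)
    have hi : Integrable (fun ω => |(randomIndex Y n ω : ℝ) - n * ν| + 1) P :=
      ((hNL n).1.integrable one_le_two).abs.add (integrable_const _)
    have hi' : Integrable (fun ω => |(randomIndex Y n ω : ℝ) - k n|) P :=
      hi.mono' (((hNc n).sub_const _).abs).aestronglyMeasurable
        (.of_forall fun ω => by simpa using hle ω)
    refine ⟨hi', (integral_mono hi' hi hle).trans ?_⟩
    rw [integral_add ((hNL n).1.integrable one_le_two).abs (integrable_const _), ← (hNL n).2]
    simpa using integral_abs_le_sqrt_integral_sq (hNL n).1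
  have hSN := fun n => memLp_and_integral_sum_range_random_sub_sq_le (k := k n) hX (hNm n)
    (hXN n) hL
    (fun j => integral_sum_range_sub_sq_le hst hdep hL h0 j (k n)) (hNk n).1
  have hdiff : Tendsto (fun n : ℕ => |t| * √((√w * (√n)⁻¹ + (n : ℝ)⁻¹) * C)) atTop (𝓝 0) := by
    have h1 : Tendsto (fun n : ℕ => (√n)⁻¹) atTop (𝓝 0) := tendsto_inv_atTop_zero.comp
      (Real.tendsto_sqrt_atTop.comp tendsto_natCast_atTop_atTop)
    have h2 := ((Real.continuous_sqrt.tendsto _).comp (((h1.const_mul √w).add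
      (tendsto_inv_atTop_nhds_zero_nat (𝕜 := ℝ))).mul_const C)).const_mul |t|
    simpa using h2
  have hle : ∀ n : ℕ, ‖charFun (P.map fun ω => (√n)⁻¹ * (∑ i ∈ Finset.range (randomIndex Y n ω),
        X i ω + μ * (randomIndex Y n ω - n * ν))) t -
      charFun (P.map fun ω => (√n)⁻¹ * ∑ i ∈ Finset.range (k n), X i ω +
        μ * ((√n)⁻¹ * ((randomIndex Y n ω : ℝ) - n * ν))) t‖ ≤
      |t| * √((√w * (√n)⁻¹ + (n : ℝ)⁻¹) * C) := fun n => by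
    set A := fun ω => (√n)⁻¹ *
      (∑ i ∈ Finset.range (randomIndex Y n ω), X i ω + μ * (randomIndex Y n ω - n * ν)) with hA
    set B := fun ω => (√n)⁻¹ * ∑ i ∈ Finset.range (k n), X i ω +
      μ * ((√n)⁻¹ * ((randomIndex Y n ω : ℝ) - n * ν)) with hBdef
    have hAB : ∀ ω, A ω - B ω = (√n)⁻¹ *
        (∑ i ∈ Finset.range (randomIndex Y n ω), X i ω - ∑ i ∈ Finset.range (k n), X i ω) :=
      fun ω => by simp only [hA, hBdef]; ring
    have hAm : AEMeasurable A P :=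
      (((measurable_sum_range_random hX (hNm n)).add
        (((hNc n).sub_const _).const_mul _)).const_mul _).aemeasurable
    have hBm' : AEMeasurable B P := (hSm n).add (hBm n)
    refine (norm_charFun_map_sub_le hAm hBm' ?_ t).trans ?_
    · simp_rw [hAB]
      exact (hSN n).1.const_mul _
    · gcongr
      simp_rw [hAB, mul_pow]
      rw [integral_const_mul, inv_pow, Real.sq_sqrt (by positivity)]
      calc (n : ℝ)⁻¹ * _ ≤ (n : ℝ)⁻¹ * ((√(n * w) + 1) * C) := by
            gcongr
            exact (hSN n).2.trans (by gcongr; exact (hNk n).2)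
        _ = _ := by
            rw [Real.sqrt_mul (by positivity)]
            rcases Nat.eq_zero_or_pos n with rfl | hn
            · simp
            · have h1 : (0 : ℝ) < n := by exact_mod_cast hn
              have h2 : (n : ℝ)⁻¹ * √n = (√n)⁻¹ := by
                rw [inv_mul_eq_div, Real.sqrt_div_self]
              linear_combination √w * C * h2
  simpa using (squeeze_zero_norm hle hdiff).add hB'

end RandomSum

/-- Sequences are indexed from `0`: `X 0`, `X 1`, … are the first,
second, … terms, and `∑ i ∈ Finset.range N, X i ω` is the sum of the first `N` terms. -/
theorem theorem2p3 {Ω : Type*} [MeasurableSpace Ω] (P : Measure Ω) [IsProbabilityMeasure P]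
    (m : ℕ) (X : ℕ → Ω → ℝ) (Y : ℕ → Ω → ℕ)
    (hXmeas : ∀ i, Measurable (X i)) (hYmeas : ∀ i, Measurable (Y i))
    (hXnonneg : ∀ i, ∀ᵐ ω ∂P, 0 ≤ X i ω)
    (hXstat : IsStationaryProcess X P) (hXdep : IsMDependent m X P)
    (hX3 : Integrable (fun ω => |X 0 ω| ^ 3) P)
    (hYindep : iIndepFun Y P) (hYident : ∀ i, IdentDistrib (Y i) (Y 0) P P)
    (hY3 : Integrable (fun ω => |(Y 0 ω : ℝ)| ^ 3) P)
    (hXY : IndepFun (fun ω i => X i ω) (fun ω i => Y i ω) P)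
    (μ σ ν τ : ℝ) (a : ℕ → ℝ)
    (hμ : μ = ∫ ω, X 0 ω ∂P) (hσ : σ ^ 2 = Var[X 0; P])
    (ha : ∀ j, a j = cov[X 0, X j; P])
    (hν : ν = ∫ ω, (Y 0 ω : ℝ) ∂P) (hτ : τ ^ 2 = Var[fun ω => (Y 0 ω : ℝ); P])
    (hμpos : 0 < μ) (hσpos : 0 < σ ^ 2) (hapos : 0 < σ ^ 2 + 2 * ∑ j ∈ Finset.Icc 1 m, a j)
    (hνpos : 0 < ν) (hτpos : 0 < τ ^ 2) :
    TendstoInDistribution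
      (fun (n : ℕ) ω =>
        ((∑ i ∈ Finset.range (randomIndex Y n ω), X i ω) - n * μ * ν) /
          √(n * (ν * σ ^ 2 + 2 * ν * (∑ j ∈ Finset.Icc 1 m, a j) + τ ^ 2 * μ ^ 2)))
      atTop (id : ℝ → ℝ) (fun _ => P) (gaussianReal 0 1) := by
  set V := ν * σ ^ 2 + 2 * ν * (∑ j ∈ Finset.Icc 1 m, a j) + τ ^ 2 * μ ^ 2 with hV
  have hV' : V = ν * (σ ^ 2 + 2 * ∑ j ∈ Finset.Icc 1 m, a j) + τ ^ 2 * μ ^ 2 := by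
    rw [hV]; ring
  have hVpos : 0 < V := by rw [hV']; positivity
  -- The variance takes the junk value `0` outside `L²`, so a positive variance gives
  -- square integrability.
  have hXL0 : MemLp (X 0) 2 P :=
    memLp_two_of_variance_ne_zero (hXmeas 0).aestronglyMeasurable (hσ ▸ hσpos.ne')
  have hYL : MemLp (fun ω => (Y 0 ω : ℝ)) 2 P :=
    memLp_two_of_variance_ne_zero
      (measurable_from_nat.comp (hYmeas 0)).aestronglyMeasurable (hτ ▸ hτpos.ne')
  have hXL : ∀ i, MemLp (X i) 2 P := fun i => (hXstat.identDistrib i).memLp_iff.2 hXL0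
  have hmean : ∀ i, ∫ ω, X i ω ∂P = μ := fun i => by
    rw [(hXstat.identDistrib i).integral_eq, hμ]
  set Z : ℕ → Ω → ℝ := fun i ω => X i ω - μ with hZ
  have hcov : ∀ j, ∫ ω, Z 0 ω * Z j ω ∂P = cov[X 0, X j; P] := fun j => by
    rw [covariance, hmean, hmean]
  have hv : σ ^ 2 + 2 * ∑ j ∈ Finset.Icc 1 m, a j =
      ∫ ω, Z 0 ω * Z 0 ω ∂P + 2 * ∑ j ∈ Finset.range m, ∫ ω, Z 0 ω * Z (j + 1) ω ∂P := by
    rw [hcov, covariance_self (hXmeas 0).aemeasurable, ← hσ, Finset.sum_congr rfl fun j _ =>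
      (hcov (j + 1)).trans (ha (j + 1)).symm, Finset.range_eq_Ico, Finset.sum_Ico_add' a 0 m 1,
      zero_add, Finset.Ico_add_one_right_eq_Icc]
  have hZY : IndepFun (fun ω i => Z i ω) (fun ω i => Y i ω) P :=
    hXY.comp (φ := fun x i => x i - μ) (ψ := id) (by fun_prop) measurable_id
  have key := tendsto_charFun_random_sum (μ := μ) (fun i => (hXmeas i).sub_const μ) hYmeas
    (hXstat.sub_const μ) (hXdep.sub_const μ) (fun i => (hXL i).sub (memLp_const μ))
    (fun i => by
      rw [integral_sub ((hXL i).integrable one_le_two) (integrable_const μ), hmean]; simp)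
    hYindep hYident hYL hZY hv hapos hν hνpos
  have hNm := measurable_randomIndex hYmeas
  have hSm : ∀ n, Measurable fun ω => ∑ i ∈ Finset.range (randomIndex Y n ω), X i ω := fun n =>
    measurable_sum_range_random hXmeas (hNm n)
  have hNc : ∀ n, Measurable fun ω => (randomIndex Y n ω : ℝ) := fun n =>
    measurable_from_nat.comp (hNm n)
  refine ⟨fun n => (((hSm n).sub_const _).div_const _).aemeasurable, aemeasurable_id,
    ProbabilityMeasure.tendsto_iff_tendsto_charFun.2 fun t => ?_⟩
  simp only [ProbabilityMeasure.coe_mk, Measure.map_id, charFun_gaussianReal]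
  have h := key ((√V)⁻¹ * t)
  rw [← hτ, ← hV'] at h
  convert h using 2 with n
  · rw [← charFun_map_mul_comp]
    · congr 2
      ext ω
      simp only [Finset.sum_sub_distrib, Finset.sum_const, Finset.card_range, nsmul_eq_mul]
      rw [Real.sqrt_mul (by positivity), div_eq_inv_mul, mul_inv]
      ring
    · simp only [Finset.sum_sub_distrib, Finset.sum_const, Finset.card_range, nsmul_eq_mul]
      have h1 := hSm n
      have h2 := hNc n
      fun_prop
  · rw [mul_pow, inv_pow, Real.sq_sqrt hVpos.le, ← mul_assoc, mul_inv_cancel₀ hVpos.ne']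
    congr 1
    push_cast
    simp
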